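/- Let $\mathcal G$ be a connected metric graph with finitely many vertices and edges (multiple edges and self-loops are allowed): each edge $e$ is identified, through a coordinate, with an interval $[0,\ell_e]$, $0<\ell_e<\infty$, or with a half-line $[0,+\infty)$, and the edges are joined at their endpoints, the vertices of $\mathcal G$ (a half-line only at its coordinate $0$). Assume that $\mathcal G$ is noncompact, that is, that at least one edge is a half-line. Let $H^1(\mathcal G)$ be the space of the real-valued continuous functions $u$ on $\mathcal G$ whose restriction to each edge $e$ belongs to $H^1(e)$, and for $\mu\ge 0$ and $2<p<6$ let $$H^1_\mu(\mathcal G)=\Big\{u\in H^1(\mathcal G):\int_{\mathcal G}|u|^2\,dx=\mu\Big\},\qquad E(u,\mathcal G)=\frac12\int_{\mathcal G}|u'|^2\,dx-\frac1p\int_{\mathcal G}|u|^p\,dx,\qquad \beta=\frac{p-2}{6-p}.$$ **Lemma.** For every $p\in(2,6)$ there is a constant $C_p>0$, depending only on $p$, such that for every $\mathcal G$ as above, every $\mu\ge0$ and every $u\in H^1_\mu(\mathcal G)$ with $$E(u,\mathcal G)\le\frac12\inf_{v\in H^1_\mu(\mathcal G)}E(v,\mathcal G)$$ one has $$C_p^{-1}\mu^{2\beta+1}\le\int_{\mathcal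 G}|u'|^2\,dx\le C_p\,\mu^{2\beta+1},$$ $$C_p^{-1}\mu^{2\beta+1}\le\int_{\mathcal G}|u|^p\,dx\le C_p\,\mu^{2\beta+1},$$ $$C_p^{-1}\mu^{\beta+1}\le\|u\|_{L^\infty(\mathcal G)}^2\le C_p\,\mu^{\beta+1}.$$ -/

import Mathlib

open MeasureTheory Set
open scoped ENNReal

/-- A metric graph with vertices `V` and edges `E` (multiple edges and self-loops are allowed).
The edge `e`, with its coordinate, is the interval `[0, len e]` if `len e < ∞` and the half-line
`[0, ∞)` if `len e = ∞`. It is attached to the vertex `origin e` at the coordinate `0` and, if it is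
bounded, to the vertex `terminus e` at the coordinate `len e`. -/
structure MetricGraph (V E : Type*) where
  len : E → ℝ≥0∞
  len_pos : ∀ e, 0 < len e
  origin : E → V
  terminus : ∀ e, len e ≠ ∞ → V

namespace MetricGraph

variable {V E : Type*} (G : MetricGraph V E)

/-- The range of the coordinate on the edge `e`: `[0, len e]` or `[0, ∞)`. -/
def dom (e : E) : Set ℝ := {x | 0 ≤ x ∧ ENNReal.ofReal x ≤ G.len e}

/-- The graph is connected: any two vertices are joined by a chain of bounded edges (a half-line
has only one vertex). -/
def IsConnected : Prop :=
  (SimpleGraph.fromRel fun v w => ∃ e h, G.origin e = v ∧ G.terminus e h = w).Connected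

/-- For a graph with finitely many vertices and edges, noncompact means that at least one edge is
a half-line. -/
def IsNoncompact : Prop := ∃ e, G.len e = ∞

/-- A function on the graph is a family `u e` of functions of the coordinates (the values of `u e`
outside `G.dom e` play no role). It is continuous at the vertices if all its values at the
endpoints attached to one vertex agree. -/
def ContinuousAtVertices (u : E → ℝ → ℝ) : Prop :=
  ∃ w : V → ℝ, (∀ e, u e 0 = w (G.origin e)) ∧
    ∀ e (h : G.len e ≠ ∞), u e (G.len e).toReal = w (G.terminus e h)

/-- The Sobolev space `H¹(G)`: on each edge `u` is (locally) absolutely continuous up to the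
endpoints, `u` and its almost everywhere defined derivative are square integrable, and `u` is
continuous at the vertices. -/
structure IsH1 (u : E → ℝ → ℝ) : Prop where
  absolutelyContinuous : ∀ e, ∀ b ∈ G.dom e, AbsolutelyContinuousOnInterval (u e) 0 b
  memLp : ∀ e, MemLp (u e) 2 (volume.restrict (G.dom e))
  memLp_deriv : ∀ e, MemLp (deriv (u e)) 2 (volume.restrict (G.dom e))
  continuousAtVertices : G.ContinuousAtVertices u

/-- The `L^∞` norm on the graph, with values in `[0, ∞]`. -/
noncomputable def normLInfty (u : E → ℝ → ℝ) : ℝ≥0∞ :=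
  ⨆ e, eLpNorm (u e) ∞ (volume.restrict (G.dom e))

variable [Fintype E]

/-- The integral over the graph of a function `f`. -/
noncomputable def integral (f : E → ℝ → ℝ) : ℝ := ∑ e, ∫ x in G.dom e, f e x

/-- `∫_G |u'|² dx`. -/
noncomputable def kinetic (u : E → ℝ → ℝ) : ℝ := G.integral fun e x => |deriv (u e) x| ^ 2

/-- `∫_G |u|^p dx`. -/
noncomputable def potential (p : ℝ) (u : E → ℝ → ℝ) : ℝ := G.integral fun e x => |u e x| ^ p

/-- The energy `E(u, G) = (1/2) ∫_G |u'|² dx - (1/p) ∫_G |u|^p dx`. -/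
noncomputable def energy (p : ℝ) (u : E → ℝ → ℝ) : ℝ :=
  1 / 2 * G.kinetic u - 1 / p * G.potential p u

/-- The functions in `H¹(G)` of mass `μ`, that is with `∫_G |u|² dx = μ`. -/
def H1Mass (μ : ℝ) : Set (E → ℝ → ℝ) :=
  {u | G.IsH1 u ∧ G.integral (fun e x => |u e x| ^ 2) = μ}

/-- The infimum of the energy among the functions of mass `μ`, as an extended real number. -/
noncomputable def energyLevel (p μ : ℝ) : EReal := ⨅ v ∈ G.H1Mass μ, (G.energy p v : EReal)

end MetricGraph

namespace MetricGraph
variable {V E : Type*} {G : MetricGraph V E}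

theorem measurableSet_dom (e : E) : MeasurableSet (G.dom e) :=
  measurableSet_Ici.inter (ENNReal.measurable_ofReal measurableSet_Iic)

theorem IsH1.exists_bound {u : E → ℝ → ℝ} (h : G.IsH1 u) (e : E) :
    ∃ M : ℝ, ∀ x ∈ G.dom e, |u e x| ≤ M := by
  have hi : IntegrableOn (fun x => u e x ^ 2 + deriv (u e) x ^ 2) (G.dom e) :=
    (h.memLp e).integrable_sq.add (h.memLp_deriv e).integrable_sq
  set K := ∫ x in G.dom e, (u e x ^ 2 + deriv (u e) x ^ 2)
  refine ⟨1 + (u e 0 ^ 2 + K), fun x hx => ?_⟩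
  have hac := h.absolutelyContinuous e x hx
  have hx0 : (0 : ℝ) ≤ x := hx.1
  have hsub : Ioc 0 x ⊆ G.dom e := fun y hy =>
    ⟨hy.1.le, (ENNReal.ofReal_le_ofReal hy.2).trans hx.2⟩
  have key := hac.integral_deriv_mul_eq_sub hac
  have hle : ∫ y in (0 : ℝ)..x, (deriv (u e) y * u e y + u e y * deriv (u e) y) ≤ K := by
    rw [intervalIntegral.integral_of_le hx0]
    calc _ ≤ ∫ y in Ioc 0 x, (u e y ^ 2 + deriv (u e) y ^ 2) := by
          refine integral_mono ?_ (hi.mono_set hsub) fun y => ?_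
          · have := ((hac.intervalIntegrable_deriv.mul_continuousOn hac.continuousOn).add
              (hac.intervalIntegrable_deriv.continuousOn_mul hac.continuousOn))
            exact (intervalIntegrable_iff_integrableOn_Ioc_of_le hx0).1 this
          · simp only
            nlinarith [sq_nonneg (u e y - deriv (u e) y)]
      _ ≤ K := setIntegral_mono_set hi (ae_of_all _ fun y => by positivity)
          hsub.eventuallyLE
  rw [key] at hle
  nlinarith [sq_abs (u e x), sq_nonneg (|u e x| - 1), abs_nonneg (u e x)]

/-- Functions in `H¹(G)` belong to `L^p(G)` for `p ≥ 2`, so that the energy is well defined. -/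
theorem IsH1.integrableOn_rpow {u : E → ℝ → ℝ} (h : G.IsH1 u) (e : E) {p : ℝ} (hp : 2 ≤ p) :
    IntegrableOn (fun x => |u e x| ^ p) (G.dom e) := by
  obtain ⟨M, hM⟩ := h.exists_bound e
  refine Integrable.mono' ((h.memLp e).integrable_sq.const_mul (M ^ (p - 2)))
    (((h.memLp e).aestronglyMeasurable.aemeasurable.norm).pow_const p).aestronglyMeasurable ?_
  filter_upwards [ae_restrict_mem (measurableSet_dom e)] with x hx
  rw [Real.norm_of_nonneg (by positivity), ← sq_abs (u e x)]
  calc |u e x| ^ p = |u e x| ^ ((p - 2) + 2) := by ring_nf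
    _ = |u e x| ^ (p - 2) * |u e x| ^ 2 := by
        rw [Real.rpow_add_of_nonneg (abs_nonneg _) (by linarith) (by norm_num)]; norm_num
    _ ≤ _ := by
        gcongr
        exact hM x hx

end MetricGraph

/-! ### Gagliardo–Nirenberg inequalities with constants independent of the graph. -/

namespace MetricGraph
variable {V E : Type*} {G : MetricGraph V E}

/-! Write `K` for the kinetic term, `P` for the potential term and `M` for the sup norm. Two
inequalities hold on every connected noncompact graph with universal constants: `M ^ 4 ≤ 36 * μ * K`
(`IsH1.toReal_normLInfty_pow_four_le`), since `u²` is controlled by its total variation once a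
half-line forces it to decay, and `P ≤ M ^ (p - 2) * μ` (`IsH1.potential_le`). A bump scaled inside
a single half-line shows that the energy level is at most `-c * μ ^ (2 * β + 1)` with `c` depending
only on `p` (`exists_energyLevel_le`), so the hypothesis on `u` gives `K / 2 - P / p ≤ -(c / 2) * μ
^ (2 * β + 1)`.

These three inequalities imply all six bounds. The powers of `μ` scale out (`exists_scaled_bounds`).
Negative energy makes `P` dominate `K`, while `P` grows at most like `K ^ ((p - 2) / 4)`, a power
below 1 because `p < 6`: this bounds everything above. Conversely `P` is bounded below by the energy
gap, hence so is `M`, hence so is `K` (`exists_rescaled_bounds`). -/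

theorem dom_of_len_eq_top {e : E} (he : G.len e = ∞) : G.dom e = Ici 0 := by
  ext x
  simp [dom, he]

theorem zero_mem_dom (e : E) : (0 : ℝ) ∈ G.dom e := by
  simp [dom]

theorem toReal_len_mem_dom (e : E) : (G.len e).toReal ∈ G.dom e :=
  ⟨ENNReal.toReal_nonneg, ENNReal.ofReal_toReal_le⟩

theorem Icc_subset_dom {e : E} {x y : ℝ} (hx : 0 ≤ x) (hy : y ∈ G.dom e) :
    Icc x y ⊆ G.dom e := fun _ hz =>
  ⟨hx.trans hz.1, (ENNReal.ofReal_le_ofReal hz.2).trans hy.2⟩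

/-- The integral of `|(u²)'|` over the edge `e`. -/
noncomputable def sqVariation (G : MetricGraph V E) (u : E → ℝ → ℝ) (e : E) : ℝ :=
  ∫ x in G.dom e, 2 * |u e x * deriv (u e) x|

theorem sqVariation_nonneg (u : E → ℝ → ℝ) (e : E) : 0 ≤ G.sqVariation u e :=
  integral_nonneg fun _ => by positivity

theorem IsH1.integrableOn_abs_sq {u : E → ℝ → ℝ} (h : G.IsH1 u) (e : E) :
    IntegrableOn (fun x => |u e x| ^ 2) (G.dom e) := by
  simp only [sq_abs]
  exact (h.memLp e).integrable_sq

theorem IsH1.integrableOn_abs_deriv_sq {u : E → ℝ → ℝ} (h : G.IsH1 u) (e : E) :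
    IntegrableOn (fun x => |deriv (u e) x| ^ 2) (G.dom e) := by
  simp only [sq_abs]
  exact (h.memLp_deriv e).integrable_sq

theorem IsH1.integrableOn_mul_deriv {u : E → ℝ → ℝ} (h : G.IsH1 u) (e : E) :
    IntegrableOn (fun x => 2 * |u e x * deriv (u e) x|) (G.dom e) :=
  ((h.memLp e).integrable_mul (h.memLp_deriv e)).abs.const_mul 2

theorem IsH1.abs_sq_sub_sq_le {u : E → ℝ → ℝ} (h : G.IsH1 u) {e : E} {x y : ℝ}
    (hx : x ∈ G.dom e) (hy : y ∈ G.dom e) : |u e y ^ 2 - u e x ^ 2| ≤ G.sqVariation u e := by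
  wlog hxy : x ≤ y generalizing x y
  · rw [abs_sub_comm]
    exact this hy hx (le_of_not_ge hxy)
  have hac : AbsolutelyContinuousOnInterval (u e) x y :=
    (h.absolutelyContinuous e y hy).mono <| by
      rw [uIcc_of_le hxy, uIcc_of_le (hx.1.trans hxy)]
      exact Icc_subset_Icc_left hx.1
  have hsub : Ioc x y ⊆ G.dom e := Ioc_subset_Icc_self.trans (Icc_subset_dom hx.1 hy)
  have key := hac.integral_deriv_mul_eq_sub hac
  have hi := h.integrableOn_mul_deriv e
  rw [show u e y ^ 2 - u e x ^ 2 = u e y * u e y - u e x * u e x by ring, ← key,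
    ← Real.norm_eq_abs]
  calc _ ≤ ∫ z in x..y, 2 * |u e z * deriv (u e) z| := by
        refine intervalIntegral.norm_integral_le_of_norm_le hxy (ae_of_all _ fun z _ => ?_)
          ((intervalIntegrable_iff_integrableOn_Ioc_of_le hxy).2 (hi.mono_set hsub))
        rw [mul_comm (deriv (u e) z), ← two_mul, Real.norm_eq_abs, abs_mul, abs_two]
    _ ≤ G.sqVariation u e := by
        rw [intervalIntegral.integral_of_le hxy]
        exact setIntegral_mono_set hi (ae_of_all _ fun z => by positivity) hsub.eventuallyLE

/-- If `u²` exceeded its variation at some point, it would stay above a positive constant on the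
whole half-line, contradicting square integrability. This is where noncompactness enters the upper
bounds. -/
theorem IsH1.sq_le_of_len_eq_top {u : E → ℝ → ℝ} (h : G.IsH1 u) {e : E} (he : G.len e = ∞)
    {x : ℝ} (hx : x ∈ G.dom e) : u e x ^ 2 ≤ G.sqVariation u e := by
  by_contra! hlt
  have hi := (h.memLp e).integrable_sq
  have hc : IntegrableOn (fun _ => u e x ^ 2 - G.sqVariation u e) (G.dom e) := by
    refine Integrable.mono' hi aestronglyMeasurable_const ?_
    filter_upwards [ae_restrict_mem (measurableSet_dom e)] with y hy
    have := abs_le.1 (h.abs_sq_sub_sq_le hx hy)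
    rw [Real.norm_of_nonneg (by linarith)]
    linarith
  rw [integrableOn_const_iff, dom_of_len_eq_top he] at hc
  simp [(sub_pos.2 hlt).ne'] at hc

/-- A vertex function is controlled along paths by the sum of its increments over all edges. -/
theorem abs_sub_le_sum_of_isConnected [Fintype E] (hG : G.IsConnected) (f : V → ℝ) (c : E → ℝ)
    (hc : ∀ e, 0 ≤ c e)
    (hf : ∀ e (h : G.len e ≠ ∞), |f (G.terminus e h) - f (G.origin e)| ≤ c e) (v w : V) :
    |f v - f w| ≤ ∑ e, c e := by
  classical
  -- Parallel edges give the same edge of the simple graph `H`, so `d` collects the increments of a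
  -- whole fibre of `ends`. Distinct fibres are disjoint, and a path repeats no edge of `H`, so each
  -- `c e` is counted at most once.
  let ends : E → Option (Sym2 V) := fun e =>
    if h : G.len e ≠ ∞ then some s(G.origin e, G.terminus e h) else none
  let d : Sym2 V → ℝ := fun s => ∑ e with ends e = some s, c e
  have hd : ∀ s, 0 ≤ d s := fun s => Finset.sum_nonneg fun e _ => hc e
  set H := SimpleGraph.fromRel fun v w => ∃ e h, G.origin e = v ∧ G.terminus e h = w
  have step : ∀ a b, H.Adj a b → |f a - f b| ≤ d s(a, b) := by
    have aux : ∀ a b, (∃ e h, G.origin e = a ∧ G.terminus e h = b) → |f a - f b| ≤ d s(a, b) := by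
      rintro a b ⟨e, h, rfl, rfl⟩
      rw [abs_sub_comm]
      refine (hf e h).trans (Finset.single_le_sum (f := c) (fun i _ => hc i) ?_)
      simp [ends, h]
    intro a b hab
    rcases ((SimpleGraph.fromRel_adj _ a b).1 hab).2 with h | h
    · exact aux a b h
    · rw [abs_sub_comm, Sym2.eq_swap]
      exact aux b a h
  have walk : ∀ {a b : V} (q : H.Walk a b), |f a - f b| ≤ (q.edges.map d).sum := by
    intro a b q
    induction q with
    | nil => simp
    | cons hab q ih =>
      rw [SimpleGraph.Walk.edges_cons, List.map_cons, List.sum_cons]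
      exact (abs_sub_le _ _ _).trans (add_le_add (step _ _ hab) ih)
  obtain ⟨q, hq⟩ := (hG.preconnected v w).exists_isPath
  refine (walk q).trans ?_
  rw [← List.sum_toFinset d hq.isTrail.edges_nodup]
  simp only [d]
  rw [← Finset.sum_biUnion]
  · exact Finset.sum_le_sum_of_subset_of_nonneg (Finset.subset_univ _) fun e _ _ => hc e
  · intro s _ t _ hst
    refine Finset.disjoint_left.2 fun e hs ht => hst ?_
    simp only [Finset.mem_filter, Finset.mem_univ, true_and] at hs ht
    exact Option.some_injective _ (hs.symm.trans ht)

variable [Fintype E]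

/-- The 3 counts three legs: from the point to the origin of its edge, from there through the graph
to the half-line's vertex, and from that vertex out to infinity. -/
theorem IsH1.sq_le_sum_sqVariation (hG : G.IsConnected) (hnc : G.IsNoncompact) {u : E → ℝ → ℝ}
    (h : G.IsH1 u) {e : E} {x : ℝ} (hx : x ∈ G.dom e) :
    u e x ^ 2 ≤ 3 * ∑ e, G.sqVariation u e := by
  obtain ⟨e₀, he₀⟩ := hnc
  obtain ⟨w, hw₀, hw₁⟩ := h.continuousAtVertices
  have h1 := h.sq_le_of_len_eq_top he₀ (zero_mem_dom e₀)
  have h2 := (abs_le.1 (h.abs_sq_sub_sq_le (zero_mem_dom e) hx)).2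
  have h3 := (abs_le.1 (abs_sub_le_sum_of_isConnected hG (fun v => w v ^ 2) (G.sqVariation u)
    (sqVariation_nonneg u) (fun e he => by
      rw [← hw₀, ← hw₁]
      exact h.abs_sq_sub_sq_le (zero_mem_dom e) (toReal_len_mem_dom e))
    (G.origin e) (G.origin e₀))).2
  rw [← hw₀, ← hw₀] at h3
  have hsum : ∀ e, G.sqVariation u e ≤ ∑ e, G.sqVariation u e := fun e =>
    Finset.single_le_sum (fun i _ => sqVariation_nonneg u i) (Finset.mem_univ e)
  linarith [hsum e, hsum e₀]

/-- Cauchy–Schwarz over all edges at once: the integral of `(t * |u| - |u'|) ^ 2` is a nonnegative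
quadratic in `t`, so its discriminant is nonpositive. -/
theorem IsH1.sq_sum_sqVariation_le {u : E → ℝ → ℝ} (h : G.IsH1 u) :
    (∑ e, G.sqVariation u e) ^ 2 ≤ 4 * (G.integral (fun e x => |u e x| ^ 2) * G.kinetic u) := by
  have key : ∀ t : ℝ, 0 ≤ G.integral (fun e x => |u e x| ^ 2) * (t * t) +
      (-∑ e, G.sqVariation u e) * t + G.kinetic u := by
    intro t
    simp only [integral, kinetic, sqVariation]
    rw [← Finset.sum_neg_distrib, Finset.sum_mul, Finset.sum_mul, ← Finset.sum_add_distrib,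
      ← Finset.sum_add_distrib]
    refine Finset.sum_nonneg fun e _ => ?_
    have i1 := h.integrableOn_abs_sq e
    have i2 := h.integrableOn_abs_deriv_sq e
    have i3 := h.integrableOn_mul_deriv e
    have i4 : IntegrableOn (fun x => -(2 * |u e x * deriv (u e) x|) * t) (G.dom e) :=
      i3.neg.mul_const t
    rw [← integral_neg, ← integral_mul_const, ← integral_mul_const,
      ← integral_add (i1.mul_const _) i4,
      ← integral_add (by exact (i1.mul_const _).add i4) i2]
    refine integral_nonneg fun x => ?_
    simp only [Pi.zero_apply, abs_mul]
    nlinarith [sq_nonneg (|u e x| * t - |deriv (u e) x|)]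
  have := discrim_le_zero key
  rw [discrim] at this
  linarith

/-- The Gagliardo–Nirenberg inequality in `L^∞`, in the form `|u|⁴ ≤ C ‖u‖₂² ‖u'‖₂²`. -/
theorem IsH1.pow_four_le (hG : G.IsConnected) (hnc : G.IsNoncompact) {u : E → ℝ → ℝ}
    (h : G.IsH1 u) {e : E} {x : ℝ} (hx : x ∈ G.dom e) :
    u e x ^ 4 ≤ 36 * (G.integral (fun e x => |u e x| ^ 2) * G.kinetic u) := by
  have h1 := h.sq_le_sum_sqVariation hG hnc hx
  have h2 := h.sq_sum_sqVariation_le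
  have h3 := pow_le_pow_left₀ (sq_nonneg (u e x)) h1 2
  nlinarith

theorem integral_nonneg' {f : E → ℝ → ℝ} (hf : ∀ e x, 0 ≤ f e x) : 0 ≤ G.integral f :=
  Finset.sum_nonneg fun e _ => integral_nonneg fun x => hf e x

theorem kinetic_nonneg (u : E → ℝ → ℝ) : 0 ≤ G.kinetic u :=
  integral_nonneg' fun _ _ => by positivity

theorem potential_nonneg (p : ℝ) (u : E → ℝ → ℝ) : 0 ≤ G.potential p u :=
  integral_nonneg' fun _ _ => by positivity

theorem IsH1.normLInfty_le (hG : G.IsConnected) (hnc : G.IsNoncompact) {u : E → ℝ → ℝ}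
    (h : G.IsH1 u) : G.normLInfty u ≤ ENNReal.ofReal
      √√(36 * (G.integral (fun e x => |u e x| ^ 2) * G.kinetic u)) := by
  refine iSup_le fun e => ?_
  rw [eLpNorm_exponent_top]
  refine eLpNormEssSup_le_of_ae_bound ?_
  filter_upwards [ae_restrict_mem (measurableSet_dom e)] with x hx
  rw [Real.norm_eq_abs]
  refine Real.abs_le_sqrt (Real.le_sqrt_of_sq_le ?_)
  rw [← pow_mul]
  exact h.pow_four_le hG hnc hx

theorem IsH1.normLInfty_ne_top (hG : G.IsConnected) (hnc : G.IsNoncompact) {u : E → ℝ → ℝ}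
    (h : G.IsH1 u) : G.normLInfty u ≠ ∞ :=
  ne_top_of_le_ne_top ENNReal.ofReal_ne_top (h.normLInfty_le hG hnc)

theorem IsH1.toReal_normLInfty_pow_four_le (hG : G.IsConnected) (hnc : G.IsNoncompact)
    {u : E → ℝ → ℝ} (h : G.IsH1 u) : (G.normLInfty u).toReal ^ 4 ≤
      36 * (G.integral (fun e x => |u e x| ^ 2) * G.kinetic u) := by
  have hnn : 0 ≤ 36 * (G.integral (fun e x => |u e x| ^ 2) * G.kinetic u) :=
    mul_nonneg (by norm_num)
      (mul_nonneg (integral_nonneg' fun _ _ => by positivity) (kinetic_nonneg u))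
  have := ENNReal.toReal_le_of_le_ofReal (Real.sqrt_nonneg _) (h.normLInfty_le hG hnc)
  refine (pow_le_pow_left₀ ENNReal.toReal_nonneg this 4).trans_eq ?_
  rw [show 4 = 2 * 2 from rfl, pow_mul, Real.sq_sqrt (Real.sqrt_nonneg _), Real.sq_sqrt hnn]

theorem IsH1.potential_le {u : E → ℝ → ℝ} (h : G.IsH1 u) {p : ℝ} (hp : 2 ≤ p)
    (hfin : G.normLInfty u ≠ ∞) :
    G.potential p u ≤
      (G.normLInfty u).toReal ^ (p - 2) * G.integral (fun e x => |u e x| ^ 2) := by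
  rw [potential, integral, integral, Finset.mul_sum]
  refine Finset.sum_le_sum fun e _ => ?_
  rw [← integral_const_mul]
  have i1 := h.integrableOn_abs_sq e
  refine integral_mono_ae (h.integrableOn_rpow e hp) (i1.const_mul _) ?_
  filter_upwards [ae_le_eLpNormEssSup (f := u e) (μ := volume.restrict (G.dom e))] with x hx
  have hle : |u e x| ≤ (G.normLInfty u).toReal := by
    rw [← Real.norm_eq_abs, ← toReal_enorm]
    refine ENNReal.toReal_mono hfin (hx.trans ?_)
    rw [← eLpNorm_exponent_top]
    exact le_iSup (fun e => eLpNorm (u e) ∞ (volume.restrict (G.dom e))) e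
  calc |u e x| ^ p = |u e x| ^ ((p - 2) + 2) := by ring_nf
    _ = |u e x| ^ (p - 2) * |u e x| ^ 2 := by
        rw [Real.rpow_add_of_nonneg (abs_nonneg _) (by linarith) (by norm_num)]; norm_num
    _ ≤ _ := by
        gcongr

end MetricGraph

/-! ### Upper bound on the energy level from a competitor on a half-line. -/

namespace MetricGraph
variable {V E : Type*} {G : MetricGraph V E}

/-- A smooth function with compact support in the open half-line, extended by zero to the graph. -/
theorem isH1_single [DecidableEq E] {e₀ : E} {f : ℝ → ℝ} (he : G.len e₀ = ∞)
    (hf : ContDiff ℝ 1 f) (hs : HasCompactSupport f) (h0 : f 0 = 0) : G.IsH1 (Pi.single e₀ f) := by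
  have hz : deriv (0 : ℝ → ℝ) = 0 := deriv_zero
  refine ⟨fun e b _ => ?_, fun e => ?_, fun e => ?_, fun _ => 0, fun e => ?_, fun e h => ?_⟩
  · refine ContDiffOn.absolutelyContinuousOnInterval (ContDiff.contDiffOn ?_)
    rcases eq_or_ne e e₀ with rfl | hne
    · simpa using hf
    · rw [Pi.single_eq_of_ne hne]
      exact contDiff_const
  · rcases eq_or_ne e e₀ with rfl | hne
    · simpa using (hf.continuous.memLp_of_hasCompactSupport hs).restrict _
    · simp [hne]
  · rcases eq_or_ne e e₀ with rfl | hne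
    · simpa using ((hf.continuous_deriv le_rfl).memLp_of_hasCompactSupport hs.deriv).restrict _
    · simp [hne, hz]
  · rcases eq_or_ne e e₀ with rfl | hne
    · simpa using h0
    · simp [hne]
  · have hne : e ≠ e₀ := by rintro rfl; exact h he
    simp [hne]

variable [Fintype E]

theorem integral_eq_of_single {e₀ : E} (he : G.len e₀ = ∞) {F : E → ℝ → ℝ} {g : ℝ → ℝ}
    (hF : F e₀ = g) (hne : ∀ e ≠ e₀, F e = 0) (hg : ∀ x < 0, g x = 0) :
    G.integral F = ∫ x, g x := by
  rw [integral, Finset.sum_eq_single e₀ (fun e _ h => by simp [hne e h]) (by simp), hF,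
    dom_of_len_eq_top he]
  exact setIntegral_eq_integral_of_forall_compl_eq_zero fun x hx => hg x (not_le.1 hx)

theorem energyLevel_le {p μ : ℝ} {v : E → ℝ → ℝ} (hv : v ∈ G.H1Mass μ) :
    G.energyLevel p μ ≤ (G.energy p v : EReal) :=
  iInf₂_le v hv

/-- The energy level of a graph with a half-line is at most that of any rescaled profile. -/
theorem energyLevel_le_of_profile (hnc : G.IsNoncompact) {p : ℝ} (hp : 0 < p) {f : ℝ → ℝ}
    (hf : ContDiff ℝ 1 f) (hs : HasCompactSupport f) (hpos : ∀ x ≤ 0, f x = 0)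
    {a b : ℝ} (ha : 0 < a) (hb : 0 < b) {μ : ℝ} (hμ : b ^ 2 * a * ∫ x, f x ^ 2 = μ) :
    G.energyLevel p μ ≤ ((1 / 2 * (b ^ 2 / a * ∫ x, deriv f x ^ 2) -
      1 / p * (b ^ p * a * ∫ x, |f x| ^ p) : ℝ) : EReal) := by
  classical
  obtain ⟨e₀, he⟩ := hnc
  set g : ℝ → ℝ := fun x => b * f (x / a) with hgdef
  have hg : ContDiff ℝ 1 g := contDiff_const.mul (hf.comp (contDiff_id.div_const a))
  have hg0 : ∀ x ≤ 0, g x = 0 := fun x hx => by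
    simp [hgdef, hpos (x / a) (div_nonpos_of_nonpos_of_nonneg hx ha.le)]
  have hgs : HasCompactSupport g := by
    have : HasCompactSupport fun x => f (x / a) := by
      simpa only [div_eq_inv_mul, smul_eq_mul] using hs.comp_smul (inv_ne_zero ha.ne')
    exact this.mul_left
  have hdg : ∀ x, deriv g x = b / a * deriv f (x / a) := fun x => by
    have h1 : HasDerivAt f (deriv f (x / a)) (x / a) :=
      (hf.differentiable one_ne_zero _).hasDerivAt
    have h2 : HasDerivAt (fun x : ℝ => x / a) (1 / a) x := (hasDerivAt_id x).div_const a
    have h3 : HasDerivAt g (b * (deriv f (x / a) * (1 / a))) x := (h1.comp x h2).const_mul b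
    rw [h3.deriv]
    ring
  have hdg0 : ∀ x < 0, deriv g x = 0 := fun x hx => by
    have : g =ᶠ[nhds x] fun _ => 0 := by
      filter_upwards [Iio_mem_nhds hx] with y hy using hg0 y (le_of_lt hy)
    rw [this.deriv_eq, deriv_const]
  have hz : deriv (0 : ℝ → ℝ) = 0 := deriv_zero
  have hmass : G.integral (fun e x => |(Pi.single e₀ g : E → ℝ → ℝ) e x| ^ 2) = μ := by
    rw [integral_eq_of_single he (g := fun x => b ^ 2 * f (x / a) ^ 2)
      (by ext x; simp [hgdef, mul_pow]) (fun e hne => by ext x; simp [hne])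
      (fun x hx => by rw [← mul_pow]; exact (sq_eq_zero_iff).2 (hg0 x hx.le)),
      integral_const_mul, Measure.integral_comp_div (fun x => f x ^ 2) a, abs_of_pos ha,
      smul_eq_mul, ← hμ]
    ring
  have hkin : G.kinetic (Pi.single e₀ g) = b ^ 2 / a * ∫ x, deriv f x ^ 2 := by
    rw [kinetic, integral_eq_of_single he (g := fun x => (b / a) ^ 2 * deriv f (x / a) ^ 2)
      (by ext x; simp [hdg, mul_pow]) (fun e hne => by ext x; simp [hne, hz])
      (fun x hx => by rw [← mul_pow, ← hdg]; exact (sq_eq_zero_iff).2 (hdg0 x hx)),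
      integral_const_mul, Measure.integral_comp_div (fun x => deriv f x ^ 2) a, abs_of_pos ha,
      smul_eq_mul]
    field_simp
  have hpot : G.potential p (Pi.single e₀ g) = b ^ p * a * ∫ x, |f x| ^ p := by
    have hmul : ∀ x, |g x| ^ p = b ^ p * |f (x / a)| ^ p := fun x => by
      rw [hgdef, abs_mul, abs_of_pos hb, Real.mul_rpow hb.le (abs_nonneg _)]
    rw [potential, integral_eq_of_single he (g := fun x => b ^ p * |f (x / a)| ^ p)
      (by ext x; simp [hmul]) (fun e hne => by ext x; simp [hne, hp.ne'])
      (fun x hx => by rw [← hmul, hg0 x hx.le, abs_zero, Real.zero_rpow hp.ne']),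
      integral_const_mul, Measure.integral_comp_div (fun x => |f x| ^ p) a, abs_of_pos ha,
      smul_eq_mul]
    ring
  refine (energyLevel_le ⟨isH1_single he hg hgs (hg0 0 le_rfl), hmass⟩).trans_eq ?_
  rw [energy, hkin, hpot]

/-- A smooth profile supported in the half-line, with nontrivial `L²` and `L^p` norms. -/
theorem exists_profile {p : ℝ} (hp : 0 < p) : ∃ f : ℝ → ℝ, ContDiff ℝ 1 f ∧ HasCompactSupport f ∧
    (∀ x ≤ 0, f x = 0) ∧ 0 < ∫ x, f x ^ 2 ∧ 0 < ∫ x, |f x| ^ p := by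
  -- Centre 2 and outer radius 2 make the bump vanish for `x ≤ 0`.
  obtain ⟨φ, hφ⟩ : ∃ φ : ContDiffBump (2 : ℝ), φ.rOut = 2 :=
    ⟨⟨1, 2, one_pos, one_lt_two⟩, rfl⟩
  have h2 : φ 2 ≠ 0 := (φ.pos_of_mem_ball (by simp [hφ])).ne'
  refine ⟨φ, φ.contDiff, φ.hasCompactSupport, fun x hx => φ.zero_of_le_dist ?_, ?_, ?_⟩
  · rw [hφ, Real.dist_eq, abs_sub_comm]
    exact (show (2 : ℝ) ≤ 2 - x by linarith).trans (le_abs_self _)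
  · refine Continuous.integral_pos_of_hasCompactSupport_nonneg_nonzero (x := 2)
      (φ.continuous.pow 2) ?_ (fun x => sq_nonneg _) (pow_ne_zero 2 h2)
    exact φ.hasCompactSupport.comp_left (g := fun y : ℝ => y ^ 2) (by simp)
  · refine Continuous.integral_pos_of_hasCompactSupport_nonneg_nonzero (x := 2)
      (φ.continuous.abs.rpow_const fun _ => Or.inr hp.le) ?_
      (fun x => by positivity) (Real.rpow_pos_of_pos (abs_pos.2 h2) p).ne'
    exact φ.hasCompactSupport.comp_left (g := fun y : ℝ => |y| ^ p) (by simp [hp.ne'])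

theorem exists_energyLevel_le {p : ℝ} (hp : 2 < p) (hp' : p < 6) : ∃ c : ℝ, 0 < c ∧
    ∀ {V E : Type*} [Fintype E] (G : MetricGraph V E), G.IsNoncompact → ∀ μ : ℝ, 0 < μ →
      G.energyLevel p μ ≤ ((-(c * μ ^ (2 * ((p - 2) / (6 - p)) + 1)) : ℝ) : EReal) := by
  obtain ⟨f, hf, hs, h0, hA, hD⟩ := exists_profile (p := p) (by linarith)
  set A := ∫ x, f x ^ 2
  set D := ∫ x, |f x| ^ p
  set B := ∫ x, deriv f x ^ 2
  have h6 : 0 < 6 - p := by linarith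
  -- At width `l * μ ^ (-β)` the energy is `μ ^ (2 * β + 1) / l ^ 2` times the difference of these
  -- two sides without the `+ 1`. As `p < 6`, a wide enough profile makes that factor at most `-1`,
  -- so `c = 1 / l ^ 2` works.
  obtain ⟨l, hl, hl1⟩ : ∃ l : ℝ, 0 < l ∧
      B / (2 * A) + 1 ≤ A ^ (-(p / 2)) * D / p * l ^ ((6 - p) / 2) := by
    have hk : 0 < A ^ (-(p / 2)) * D / p := by positivity
    have ht := (tendsto_rpow_atTop (half_pos h6)).const_mul_atTop hk
    obtain ⟨l, h1, h2⟩ := ((ht.eventually_ge_atTop (B / (2 * A) + 1)).and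
      (Filter.eventually_gt_atTop 0)).exists
    exact ⟨l, h2, h1⟩
  refine ⟨(l ^ 2)⁻¹, by positivity, fun {V E} _ G hnc μ hμ => ?_⟩
  set β := (p - 2) / (6 - p) with hβ
  set a := l * μ ^ (-β) with ha
  have hμβ : 0 < μ ^ (-β) := Real.rpow_pos_of_pos hμ _
  have ha0 : 0 < a := by positivity
  have hq : 0 < μ / (a * A) := by positivity
  refine (energyLevel_le_of_profile hnc (by linarith) hf hs h0 ha0 (Real.sqrt_pos.2 hq)
    (μ := μ) ?_).trans (EReal.coe_le_coe_iff.2 ?_)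
  · rw [Real.sq_sqrt hq.le]
    field_simp
    rfl
  rw [Real.sq_sqrt hq.le]
  have hkin : μ / (a * A) / a * B = (l ^ 2)⁻¹ * (B / A) * μ ^ (2 * β + 1) := by
    have : μ ^ (2 * β + 1) = μ / (μ ^ (-β)) ^ 2 := by
      rw [Real.rpow_add hμ, Real.rpow_one, ← Real.rpow_natCast, ← Real.rpow_mul hμ.le,
        eq_div_iff (by positivity), mul_right_comm, ← Real.rpow_add hμ]
      norm_num
      ring_nf
      simp
    rw [this, ha]
    field_simp
  have hpot : √(μ / (a * A)) ^ p * a =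
      (l ^ 2)⁻¹ * (A ^ (-(p / 2)) * l ^ ((6 - p) / 2)) * μ ^ (2 * β + 1) := by
    have h1 : -(p / 2) + 1 = -2 + (6 - p) / 2 := by ring
    have h2 : p / 2 + -β * (-(p / 2) + 1) = 2 * β + 1 := by
      rw [hβ]
      field_simp
      ring
    have h3 : a ^ (-(p / 2)) * a = l ^ (-(p / 2) + 1) * μ ^ (-β * (-(p / 2) + 1)) := by
      rw [← Real.rpow_add_one ha0.ne', ha, Real.mul_rpow hl.le hμβ.le, ← Real.rpow_mul hμ.le]
    have h4 : l ^ (-2 : ℝ) = (l ^ 2)⁻¹ := by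
      rw [Real.rpow_neg hl.le, Real.rpow_two]
    calc √(μ / (a * A)) ^ p * a = A ^ (-(p / 2)) * μ ^ (p / 2) * (a ^ (-(p / 2)) * a) := by
          rw [Real.sqrt_eq_rpow, ← Real.rpow_mul hq.le, one_div_mul_eq_div,
            Real.div_rpow hμ.le (by positivity), Real.mul_rpow ha0.le hA.le,
            Real.rpow_neg hA.le, Real.rpow_neg ha0.le]
          field_simp
      _ = l ^ (-2 : ℝ) * (A ^ (-(p / 2)) * l ^ ((6 - p) / 2)) *
            (μ ^ (p / 2) * μ ^ (-β * (-(p / 2) + 1))) := by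
          rw [h3, h1, Real.rpow_add hl]
          ring
      _ = _ := by rw [← Real.rpow_add hμ, h2, h4]
  change 1 / 2 * (_ * B) - 1 / p * (_ * D) ≤ _
  rw [hkin, hpot]
  clear_value A B D
  have hfac : 0 ≤ (l ^ 2)⁻¹ * μ ^ (2 * β + 1) := by positivity
  calc _ = (l ^ 2)⁻¹ * μ ^ (2 * β + 1) *
        (B / (2 * A) - A ^ (-(p / 2)) * D / p * l ^ ((6 - p) / 2)) := by
        field_simp
    _ ≤ (l ^ 2)⁻¹ * μ ^ (2 * β + 1) * (-1) :=
        mul_le_mul_of_nonneg_left (by linarith) hfac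
    _ = _ := by ring

end MetricGraph

/-! ### Real-variable inequalities and scaling. -/

/-- Bounds on the rescaled kinetic energy `k`, potential energy `q` and squared sup norm `m`. -/
theorem exists_rescaled_bounds {p c : ℝ} (hp : 2 < p) (hp' : p < 6) (hc : 0 < c) :
    ∃ C : ℝ, 1 ≤ C ∧ ∀ k q m : ℝ, 0 ≤ k → 0 ≤ m → m ^ 2 ≤ 36 * k → q ≤ m ^ ((p - 2) / 2) →
      1 / 2 * k - 1 / p * q ≤ -c →
      (C⁻¹ ≤ k ∧ k ≤ C) ∧ (C⁻¹ ≤ q ∧ q ≤ C) ∧ (C⁻¹ ≤ m ∧ m ≤ C) := by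
  have hp2 : 0 < (p - 2) / 2 := by linarith
  have h6 : 0 < 6 - p := by linarith
  have hp0 : 0 < p := by linarith
  -- `Y` is the positive solution of `y = 36 * y ^ ((p - 2) / 4)` and will bound `36 * k`; `m₀`
  -- solves `m ^ ((p - 2) / 2) = p * c` and will bound `m` from below.
  set Y : ℝ := 36 ^ (4 / (6 - p))
  set m₀ : ℝ := (p * c) ^ ((p - 2) / 2)⁻¹
  have hm₀ : 0 < m₀ := Real.rpow_pos_of_pos (by positivity) _
  have hY : 0 < Y := by positivity
  set C : ℝ := 1 + (Y + Y ^ ((p - 2) / 4) + √Y + (p * c)⁻¹ + m₀⁻¹ + (m₀ ^ 2 / 36)⁻¹)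
  have t1 := Real.rpow_pos_of_pos hY ((p - 2) / 4)
  have t2 := Real.sqrt_nonneg Y
  have t3 : 0 < (p * c)⁻¹ := by positivity
  have t4 : 0 < m₀⁻¹ := by positivity
  have t5 : 0 < (m₀ ^ 2 / 36)⁻¹ := by positivity
  have hC : 1 ≤ C := by simp only [C]; linarith
  refine ⟨C, hC, fun k q m hk hm hmk hqm hE => ?_⟩
  have hpq : p * c + p / 2 * k ≤ q := by
    have := mul_le_mul_of_nonneg_left hE hp0.le
    have e : p * (1 / p * q) = q := by field_simp
    rw [mul_sub, e] at this
    linarith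
  -- Uses `p / 2 > 1`.
  have hkq : k ≤ q := by nlinarith [mul_pos hp0 hc]
  have hq : p * c ≤ q := by nlinarith
  have hm1 : m₀ ≤ m := by
    rw [← Real.rpow_rpow_inv hm hp2.ne']
    exact Real.rpow_le_rpow (by positivity) (hq.trans hqm) (inv_nonneg.2 hp2.le)
  have hk1 : m₀ ^ 2 / 36 ≤ k := by
    have := pow_le_pow_left₀ hm₀.le hm1 2
    linarith
  have hk0 : 0 < 36 * k := by
    have : 0 < m₀ ^ 2 := by positivity
    linarith
  have hmy : m ^ ((p - 2) / 2) ≤ (36 * k) ^ ((p - 2) / 4) := by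
    calc m ^ ((p - 2) / 2) = (m ^ 2) ^ ((p - 2) / 4) := by
          rw [← Real.rpow_natCast, ← Real.rpow_mul hm]
          congr 1
          push_cast
          ring
      _ ≤ _ := Real.rpow_le_rpow (sq_nonneg m) hmk (by linarith)
  have hy : (36 * k) ^ ((6 - p) / 4) ≤ 36 := by
    have h1 : 36 * k ≤ 36 * (36 * k) ^ ((p - 2) / 4) := by linarith
    have h2 : 36 * k = (36 * k) ^ ((6 - p) / 4) * (36 * k) ^ ((p - 2) / 4) := by
      rw [← Real.rpow_add hk0, show (6 - p) / 4 + (p - 2) / 4 = 1 by ring, Real.rpow_one]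
    exact le_of_mul_le_mul_right (h2.symm.le.trans h1) (Real.rpow_pos_of_pos hk0 _)
  have hyY : 36 * k ≤ Y := by
    rw [← Real.rpow_rpow_inv hk0.le (show (6 - p) / 4 ≠ 0 by positivity), inv_div]
    exact Real.rpow_le_rpow (by positivity) hy (by positivity)
  have hqY : q ≤ Y ^ ((p - 2) / 4) :=
    (hqm.trans hmy).trans (Real.rpow_le_rpow hk0.le hyY (by linarith))
  have hmY : m ≤ √Y := Real.le_sqrt_of_sq_le (hmk.trans hyY)
  refine ⟨⟨?_, ?_⟩, ⟨?_, ?_⟩, ?_, ?_⟩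
  · refine (inv_le_of_inv_le₀ (by positivity) ?_).trans hk1
    simp only [C]; linarith
  · simp only [C]; linarith
  · refine (inv_le_of_inv_le₀ (by positivity) ?_).trans hq
    simp only [C]; linarith
  · simp only [C]; linarith
  · refine (inv_le_of_inv_le₀ (by positivity) ?_).trans hm1
    simp only [C]; linarith
  · simp only [C]; linarith

/-- The scaling of the mass reduces bounds at mass `μ` to bounds at mass `1`. -/
theorem exists_scaled_bounds {p c β : ℝ} (hp : 2 < p) (hp' : p < 6) (hβ : β = (p - 2) / (6 - p))
    (hc : 0 < c) :
    ∃ C : ℝ, 1 ≤ C ∧ ∀ μ K P M : ℝ, 0 < μ → 0 ≤ K → 0 ≤ M → M ^ 4 ≤ 36 * (μ * K) →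
      P ≤ M ^ (p - 2) * μ → 1 / 2 * K - 1 / p * P ≤ -(c * μ ^ (2 * β + 1)) →
      (C⁻¹ * μ ^ (2 * β + 1) ≤ K ∧ K ≤ C * μ ^ (2 * β + 1)) ∧
      (C⁻¹ * μ ^ (2 * β + 1) ≤ P ∧ P ≤ C * μ ^ (2 * β + 1)) ∧
      (C⁻¹ * μ ^ (β + 1) ≤ M ^ 2 ∧ M ^ 2 ≤ C * μ ^ (β + 1)) := by
  obtain ⟨C, hC, H⟩ := exists_rescaled_bounds hp hp' hc
  refine ⟨C, hC, fun μ K P M hμ hK hM h1 h2 h3 => ?_⟩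
  have h6 : 0 < 6 - p := by linarith
  set s := μ ^ (2 * β + 1)
  set r := μ ^ (β + 1)
  have hs : 0 < s := Real.rpow_pos_of_pos hμ _
  have hr : 0 < r := Real.rpow_pos_of_pos hμ _
  -- `hrs` and `hsr` make the two interpolation inequalities scale invariant; `hsr` is the one that
  -- determines `β`.
  have hrs : r ^ 2 = μ * s := by
    rw [← Real.rpow_natCast, ← Real.rpow_mul hμ.le, mul_comm μ, ← Real.rpow_add_one hμ.ne']
    congr 1
    push_cast
    ring
  have hsr : s = r ^ ((p - 2) / 2) * μ := by
    change μ ^ (2 * β + 1) = (μ ^ (β + 1)) ^ ((p - 2) / 2) * μ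
    rw [← Real.rpow_mul hμ.le, ← Real.rpow_add_one hμ.ne']
    congr 1
    rw [hβ]
    field_simp
    ring
  have := H (K / s) (P / s) (M ^ 2 / r) (by positivity) (by positivity) ?_ ?_ ?_
  · simpa only [le_div_iff₀ hs, div_le_iff₀ hs, le_div_iff₀ hr, div_le_iff₀ hr] using this
  · rw [div_pow, hrs, ← pow_mul, div_le_iff₀ (by positivity)]
    calc M ^ 4 ≤ 36 * (μ * K) := h1
      _ = _ := by field_simp
  · rw [Real.div_rpow (sq_nonneg M) hr.le, ← Real.rpow_natCast, ← Real.rpow_mul hM,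
      div_le_div_iff₀ hs (Real.rpow_pos_of_pos hr _),
      show ((2 : ℕ) : ℝ) * ((p - 2) / 2) = p - 2 by push_cast; ring]
    have hrp : 0 ≤ r ^ ((p - 2) / 2) := (Real.rpow_pos_of_pos hr _).le
    calc _ ≤ M ^ (p - 2) * μ * r ^ ((p - 2) / 2) := mul_le_mul_of_nonneg_right h2 hrp
      _ = _ := by rw [hsr]; ring
  · rw [show 1 / 2 * (K / s) - 1 / p * (P / s) = (1 / 2 * K - 1 / p * P) / s by ring,
      div_le_iff₀ hs]
    linarith

/-! ### Zero mass and conclusion. -/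

namespace MetricGraph
variable {V E : Type*} {G : MetricGraph V E}

theorem zero_mem_H1Mass [Fintype E] : (0 : E → ℝ → ℝ) ∈ G.H1Mass 0 := by
  have hz : deriv (0 : ℝ → ℝ) = 0 := deriv_zero
  refine ⟨⟨fun e b _ => ?_, fun e => ?_, fun e => ?_, fun _ => 0, by simp, by simp⟩, ?_⟩
  · exact ContDiffOn.absolutelyContinuousOnInterval contDiffOn_const
  · simp
  · simp [hz]
  · simp [integral]

theorem energy_zero [Fintype E] {p : ℝ} (hp : p ≠ 0) : G.energy p 0 = 0 := by
  have hz : deriv (0 : ℝ → ℝ) = 0 := deriv_zero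
  simp [energy, kinetic, potential, integral, hz, hp]

end MetricGraph

theorem lemma2p6 (p : ℝ) (hp : 2 < p) (hp' : p < 6) (β : ℝ) (hβ : β = (p - 2) / (6 - p)) :
    ∃ C : ℝ, 0 < C ∧
      ∀ (V E : Type*) [Finite V] [Fintype E] (G : MetricGraph V E),
        G.IsConnected → G.IsNoncompact →
        ∀ (μ : ℝ) (u : E → ℝ → ℝ), u ∈ G.H1Mass μ →
          (G.energy p u : EReal) ≤ ((1 / 2 : ℝ) : EReal) * G.energyLevel p μ →
          (C⁻¹ * μ ^ (2 * β + 1) ≤ G.kinetic u ∧ G.kinetic u ≤ C * μ ^ (2 * β + 1)) ∧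
          (C⁻¹ * μ ^ (2 * β + 1) ≤ G.potential p u ∧ G.potential p u ≤ C * μ ^ (2 * β + 1)) ∧
          (ENNReal.ofReal (C⁻¹ * μ ^ (β + 1)) ≤ G.normLInfty u ^ 2 ∧
            G.normLInfty u ^ 2 ≤ ENNReal.ofReal (C * μ ^ (β + 1))) := by
  obtain ⟨c, hc, hlevel⟩ := MetricGraph.exists_energyLevel_le hp hp'
  obtain ⟨C, hC, hbounds⟩ := exists_scaled_bounds hp hp' hβ (half_pos hc)
  refine ⟨C, by linarith, fun V E _ _ G hG hnc μ u ⟨hu, hmass⟩ hE => ?_⟩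
  have hβ0 : 0 < β := hβ ▸ div_pos (by linarith) (by linarith)
  have hμ : 0 ≤ μ := hmass ▸ MetricGraph.integral_nonneg' fun _ _ => by positivity
  have hK := G.kinetic_nonneg u
  have hP := G.potential_nonneg p u
  have hM4 := hu.toReal_normLInfty_pow_four_le hG hnc
  have hPM := hu.potential_le hp.le (hu.normLInfty_ne_top hG hnc)
  have htop := hu.normLInfty_ne_top hG hnc
  rw [hmass] at hM4 hPM
  -- Only upper bounds on the level are used, so its finiteness is never needed.
  have hEle : ∀ x : ℝ, G.energyLevel p μ ≤ (x : EReal) → G.energy p u ≤ 1 / 2 * x := fun x hx =>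
    EReal.coe_le_coe_iff.1 <| hE.trans <| (EReal.coe_mul (1 / 2) x).symm ▸
      mul_le_mul_of_nonneg_left hx (EReal.coe_nonneg.2 (by norm_num))
  rw [← ENNReal.ofReal_toReal htop, ← ENNReal.ofReal_pow ENNReal.toReal_nonneg]
  suffices h : (C⁻¹ * μ ^ (2 * β + 1) ≤ G.kinetic u ∧ G.kinetic u ≤ C * μ ^ (2 * β + 1)) ∧
      (C⁻¹ * μ ^ (2 * β + 1) ≤ G.potential p u ∧ G.potential p u ≤ C * μ ^ (2 * β + 1)) ∧
      (C⁻¹ * μ ^ (β + 1) ≤ (G.normLInfty u).toReal ^ 2 ∧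
        (G.normLInfty u).toReal ^ 2 ≤ C * μ ^ (β + 1)) from
    ⟨h.1, h.2.1, ENNReal.ofReal_le_ofReal h.2.2.1, ENNReal.ofReal_le_ofReal h.2.2.2⟩
  -- At `μ = 0` scaling is unavailable, but the zero competitor gives nonpositive energy and `hPM`
  -- kills the potential, so all three quantities vanish.
  rcases hμ.eq_or_lt with rfl | hμ
  · have h0 := hEle 0 ((MetricGraph.energyLevel_le MetricGraph.zero_mem_H1Mass).trans_eq
      (by rw [MetricGraph.energy_zero (by linarith)]))
    rw [mul_zero] at hPM
    have hP0 : G.potential p u = 0 := le_antisymm hPM hP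
    rw [MetricGraph.energy, hP0] at h0
    have hK0 : G.kinetic u = 0 := by linarith
    have hM0 : (G.normLInfty u).toReal = 0 :=
      pow_eq_zero_iff (four_ne_zero) |>.1 (le_antisymm (by simpa using hM4) (by positivity))
    rw [hP0, hK0, hM0, Real.zero_rpow (by linarith), Real.zero_rpow (by linarith)]
    simp
  · refine hbounds μ _ _ _ hμ hK ENNReal.toReal_nonneg hM4 hPM ?_
    have := hEle _ (hlevel G hnc μ hμ)
    rw [← hβ, MetricGraph.energy] at this
    linarith
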